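/- Let $G$ be a topological group with neutral element $e$. Write $\mathrm{RUC}_b(G)$ for the space of bounded functions $f\colon G\to\mathbb{R}$ that are uniformly continuous with respect to the right uniformity of $G$, i.e. for every $\epsilon>0$ there is a neighbourhood $V$ of $e$ such that $|f(x)-f(y)|\le\epsilon$ whenever $xy^{-1}\in V$. The topological group $G$ is *amenable* if there is a positive linear map $\mu\colon\mathrm{RUC}_b(G)\to\mathbb{R}$ with $\mu(\mathbf 1)=1$ and $\mu(x\mapsto f(gx))=\mu(f)$ for all $f\in\mathrm{RUC}_b(G)$ and $g\in G$. A group $H$ is *amenable* if there is a positive linear map $\mu\colon\ell^\infty(H)\to\mathbb{R}$ with $\mu(\mathbf 1)=1$ and $\mu(x\mapsto f(hx))=\mu(f)$ for all $f\in\ell^\infty(H)$ and $h\in H$. For a neighbourhood $U$ of $e$ let $$N_G(U)=\{\alpha\colon G\to\mathrm{Sym}(G)\mid \alpha(g)(h)\in Ugh\ \text{ for all } g,h\in G\}.$$ For sets $I,X$ and a map $\alpha\colon I\to\mathrm{Sym}(X)$ let $\Gamma(\alpha)\le\mathrm{Sym}(X)$ be the subgroup generated by $\{\alpha(i)\mid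 i\in I\}$, and let the *wobbling group* $W(\alpha)$ be the group of all $\gamma\in\mathrm{Sym}(X)$ for which there is a finite set $E\subseteq\Gamma(\alpha)$ such that for every $x\in X$ there is $\sigma\in E$ with $\gamma(x)=\sigma(x)$. Let $W_U(G)=W(\bigoplus_{\alpha\in N_G(U)}\alpha)\le\mathrm{Sym}(G\times N_G(U))$, where $\bigoplus_{\alpha\in N_G(U)}\alpha\colon G\to\mathrm{Sym}(G\times N_G(U))$ is the map sending $g$ to the permutation $(x,\alpha)\mapsto(\alpha(g)(x),\alpha)$. A subgroup of $\mathrm{Sym}(X)$ is *semi-regular* if no non-identity element of it has a fixed point in $X$. **Corollary.** Let $G$ be an amenable Hausdorff topological group and let $H$ be any group. Suppose that there exists a neighbourhood $U$ of $e$ in $G$ such that, for every $\alpha\in N_G(U)$, the group $H$ is isomorphic to a semi-regular subgroup of $W(\alpha)$. Then $H$ is amenable. Moreover, for a given neighbourhood $U$ of $e$, the condition that $H$ is isomorphic to a semi-regular subgroup of $W(\alpha)$ for every $\alpha\in N_G(U)$ holds, for example, if $H$ is isomorphic to a semi-regular subgroup of $W_U(G)$. -/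

import Mathlib

open Topology

/-- `ℓ^∞(X)`: the real vector space of all bounded real-valued functions on a set `X`. -/
def boundedFunctions (X : Type*) : Submodule ℝ (X → ℝ) where
  carrier := {f | ∃ C : ℝ, ∀ x, |f x| ≤ C}
  zero_mem' := ⟨0, fun x => by simp⟩
  add_mem' := by
    rintro f g ⟨C, hC⟩ ⟨D, hD⟩
    exact ⟨C + D, fun x => (abs_add_le _ _).trans (add_le_add (hC x) (hD x))⟩
  smul_mem' := by
    rintro c f ⟨C, hC⟩
    refine ⟨|c| * C, fun x => ?_⟩
    rw [Pi.smul_apply, smul_eq_mul, abs_mul]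
    exact mul_le_mul_of_nonneg_left (hC x) (abs_nonneg c)

theorem one_mem_boundedFunctions (X : Type*) : (1 : X → ℝ) ∈ boundedFunctions X :=
  ⟨1, fun x => by simp⟩

theorem comp_mem_boundedFunctions {X Y : Type*} (t : X → Y) {f : Y → ℝ}
    (hf : f ∈ boundedFunctions Y) : (fun x => f (t x)) ∈ boundedFunctions X := by
  obtain ⟨C, hC⟩ := hf
  exact ⟨C, fun x => hC (t x)⟩

/-- An action of a group `Γ` on a (non-empty) set `X` is amenable if `ℓ^∞(X)` admits a
`Γ`-invariant mean: a positive linear functional `μ` with `μ 1 = 1` and `μ (f ∘ g) = μ f`. -/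
def IsAmenableAction (Γ X : Type*) [Group Γ] [MulAction Γ X] : Prop :=
  ∃ μ : boundedFunctions X →ₗ[ℝ] ℝ,
    (∀ f : boundedFunctions X, (∀ x, 0 ≤ f.1 x) → 0 ≤ μ f) ∧
    μ ⟨1, one_mem_boundedFunctions X⟩ = 1 ∧
    ∀ (g : Γ) (f : boundedFunctions X),
      μ ⟨fun x => f.1 (g • x), comp_mem_boundedFunctions (fun x => g • x) f.2⟩ = μ f

/-- A (discrete) group is amenable if its action on itself by left translations is amenable. -/
def IsAmenableGroup (H : Type*) [Group H] : Prop :=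
  IsAmenableAction H H

/-- `RUC_b(G)`: the real vector space of all bounded real-valued functions on a topological group
`G` that are uniformly continuous for the right uniformity (whose entourages are generated by the
sets of pairs `(x, y)` with `y * x⁻¹ ∈ U`, for `U` an identity neighbourhood). -/
def rucb (G : Type*) [Group G] [TopologicalSpace G] [IsTopologicalGroup G] :
    Submodule ℝ (G → ℝ) where
  carrier := {f | f ∈ boundedFunctions G ∧
    @UniformContinuous G ℝ (IsTopologicalGroup.rightUniformSpace G) _ f}
  zero_mem' := by
    let := IsTopologicalGroup.rightUniformSpace G
    exact ⟨Submodule.zero_mem _, uniformContinuous_const⟩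
  add_mem' := by
    let := IsTopologicalGroup.rightUniformSpace G
    rintro f g ⟨hf, hf'⟩ ⟨hg, hg'⟩
    exact ⟨Submodule.add_mem _ hf hg, UniformContinuous.add hf' hg'⟩
  smul_mem' := by
    let := IsTopologicalGroup.rightUniformSpace G
    rintro c f ⟨hf, hf'⟩
    exact ⟨Submodule.smul_mem _ c hf, hf'.const_smul c⟩

theorem one_mem_rucb (G : Type*) [Group G] [TopologicalSpace G] [IsTopologicalGroup G] :
    (1 : G → ℝ) ∈ rucb G := by
  let := IsTopologicalGroup.rightUniformSpace G
  exact ⟨one_mem_boundedFunctions G, uniformContinuous_const⟩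

theorem leftTranslate_mem_rucb {G : Type*} [Group G] [TopologicalSpace G] [IsTopologicalGroup G]
    (g : G) {f : G → ℝ} (hf : f ∈ rucb G) : (fun x => f (g * x)) ∈ rucb G := by
  let := IsTopologicalGroup.rightUniformSpace G
  refine ⟨comp_mem_boundedFunctions (fun x => g * x) hf.1, UniformContinuous.comp hf.2 ?_⟩
  have hu : uniformity G = Filter.comap (fun p : G × G => p.2 * p.1⁻¹) (𝓝 1) := rfl
  have hc : Filter.Tendsto (fun x : G => g * x * g⁻¹) (𝓝 1) (𝓝 1) := by
    have h : Continuous (fun x : G => g * x * g⁻¹) := by fun_prop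
    simpa using h.tendsto 1
  change Filter.Tendsto _ (uniformity G) (uniformity G)
  rw [hu, Filter.tendsto_comap_iff]
  refine (hc.comp Filter.tendsto_comap).congr fun p => ?_
  simp only [Function.comp_apply]
  group

/-- A topological group `G` is amenable if `RUC_b(G)` admits a left-invariant mean. -/
def IsAmenableTopGroup (G : Type*) [Group G] [TopologicalSpace G] [IsTopologicalGroup G] : Prop :=
  ∃ μ : rucb G →ₗ[ℝ] ℝ,
    (∀ f : rucb G, (∀ x, 0 ≤ f.1 x) → 0 ≤ μ f) ∧
    μ ⟨1, one_mem_rucb G⟩ = 1 ∧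
    ∀ (g : G) (f : rucb G), μ ⟨fun x => f.1 (g * x), leftTranslate_mem_rucb g f.2⟩ = μ f

/-- The wobbling group `W(Γ, X)` of an action of `Γ` on `X`: all permutations `γ` of `X` for which
there is a finite `E ⊆ Γ` such that every `γ x` is of the form `g • x` with `g ∈ E`. -/
def wobblingGroup (Γ X : Type*) [Group Γ] [MulAction Γ X] : Subgroup (Equiv.Perm X) where
  carrier := {γ | ∃ E : Finset Γ, ∀ x, ∃ g ∈ E, γ x = g • x}
  one_mem' := ⟨{1}, fun x => ⟨1, by simp, by simp⟩⟩
  mul_mem' := by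
    classical
    rintro γ δ ⟨E, hE⟩ ⟨F, hF⟩
    refine ⟨(E ×ˢ F).image (fun p => p.1 * p.2), fun x => ?_⟩
    obtain ⟨h, hh, hx⟩ := hF x
    obtain ⟨g, hg, hy⟩ := hE (δ x)
    refine ⟨g * h, Finset.mem_image.2 ⟨(g, h), Finset.mem_product.2 ⟨hg, hh⟩, rfl⟩, ?_⟩
    rw [Equiv.Perm.mul_apply, hy, hx, mul_smul]
  inv_mem' := by
    classical
    rintro γ ⟨E, hE⟩
    refine ⟨E.image (fun g => g⁻¹), fun x => ?_⟩
    obtain ⟨g, hg, hx⟩ := hE (γ⁻¹ x)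
    refine ⟨g⁻¹, Finset.mem_image.2 ⟨g, hg, rfl⟩, ?_⟩
    rw [eq_inv_smul_iff, ← hx]
    exact γ.apply_symm_apply x

/-- `Γ(α)`: the subgroup of `Sym(X)` generated by the permutations `α i`. -/
def permGroup {I X : Type*} (α : I → Equiv.Perm X) : Subgroup (Equiv.Perm X) :=
  Subgroup.closure (Set.range α)

/-- `W(α) = W(Γ(α), X)`, for the natural action of `Γ(α) ≤ Sym(X)` on `X`. -/
def wobblingOf {I X : Type*} (α : I → Equiv.Perm X) : Subgroup (Equiv.Perm X) :=
  wobblingGroup (permGroup α) X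

/-- `⨁ j, α j : I → Sym(X × J)`, given by `(⨁ j, α j) i (x, j) = (α j i x, j)`. -/
def permSum {I X J : Type*} (α : J → I → Equiv.Perm X) : I → Equiv.Perm (X × J) :=
  fun i => Equiv.prodCongrLeft (fun j => α j i)

/-- `N_G(U)`: all maps `α : G → Sym(G)` with `α g h ∈ U * (g * h)` for all `g` and `h`, that is, the
`U`-perturbations of the left translation action of `G` on itself. -/
def perturbations {G : Type*} [Group G] (U : Set G) : Set (G → Equiv.Perm G) :=
  {α | ∀ g h : G, ∃ u ∈ U, α g h = u * (g * h)}

/-- The `U`-wobbling group `W_U(G) = W(⨁ α ∈ N_G(U), α) ≤ Sym(G × N_G(U))`. -/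
def uniformWobblingGroup {G : Type*} [Group G] (U : Set G) :
    Subgroup (Equiv.Perm (G × perturbations U)) :=
  wobblingOf (permSum fun α : perturbations U => α.1)

/-- A subgroup of `Sym(X)` is semi-regular if no non-identity element of it has a fixed point. -/
def IsSemiRegular {X : Type*} (S : Subgroup (Equiv.Perm X)) : Prop :=
  ∀ γ ∈ S, γ ≠ 1 → ∀ x, γ x ≠ x

/-- `H` is isomorphic to a semi-regular subgroup of the permutation group `W ≤ Sym(X)`. -/
def IsoSemiRegularSubgroup (H : Type*) [Group H] {X : Type*} (W : Subgroup (Equiv.Perm X)) :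
    Prop :=
  ∃ S : Subgroup (Equiv.Perm X), S ≤ W ∧ IsSemiRegular S ∧ Nonempty (H ≃* S)

/-! Two facts combine. First, an invariant mean for an action is automatically invariant under the
wobbling group, since a wobbling permutation acts piecewise by finitely many group elements. A
semi-regular subgroup acts freely, and an invariant mean on a free action pushes forward to the
acting group (`isAmenableGroup_of_free`). So it suffices to find one `α ∈ N_G(U)` for which `Γ(α)`
acts amenably on the bare set `G`.

Such an `α` comes from a topological Følner argument. Hahn–Banach separation turns the mean on
`RUC_b(G)` into finite averages that are almost invariant uniformly over 1-Lipschitz functions, and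
Hall's theorem turns this closeness into a matching of most points of `gF` with nearby points of
`F`. If `G` is not discrete, the points can be moved slightly so that the matching becomes a
finitely supported permutation with displacements in `U` (`exists_folner_permutations`). There are
only `#G` finite sets `E ⊆ G`, so the supports can be made disjoint by right translations, and all
corrections are glued into a single `α`. Since `α` need not be a homomorphism, invariance of the
limit mean is checked on the generators `α g` only. If `G` is discrete, left translation itself
serves.

The final claim holds because the wobbling group of a sum preserves each summand. -/

/-! ### Invariant means, wobbling groups and free actions. -/

section Means

variable {X : Type*}

/-- A mean is a positive normalized linear functional on the bounded functions. -/
structure IsMean (μ : boundedFunctions X →ₗ[ℝ] ℝ) : Prop where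
  nonneg : ∀ f : boundedFunctions X, (∀ x, 0 ≤ f.1 x) → 0 ≤ μ f
  map_one : μ ⟨1, one_mem_boundedFunctions X⟩ = 1

/-- Precomposition with a map, as a linear map between spaces of bounded functions. -/
def boundedComp {X Y : Type*} (t : X → Y) : boundedFunctions Y →ₗ[ℝ] boundedFunctions X where
  toFun f := ⟨fun x => f.1 (t x), comp_mem_boundedFunctions t f.2⟩
  map_add' _ _ := rfl
  map_smul' _ _ := rfl

theorem IsMean.comp {X Y : Type*} {μ : boundedFunctions X →ₗ[ℝ] ℝ} (hμ : IsMean μ) (t : X → Y) :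
    IsMean (μ ∘ₗ boundedComp t) :=
  ⟨fun _ hf => hμ.nonneg _ fun x => hf (t x), hμ.map_one⟩

/-- Multiplication of a bounded function by the indicator of a set. -/
noncomputable def boundedIndicator (s : Set X) (f : boundedFunctions X) : boundedFunctions X :=
  ⟨s.indicator f.1, by
    obtain ⟨C, hC⟩ := f.2
    refine ⟨C, fun x => ?_⟩
    by_cases hx : x ∈ s
    · simpa [hx] using hC x
    · simpa [hx] using (abs_nonneg _).trans (hC x)⟩

/-- An invariant mean for an action is invariant under its wobbling group. -/
theorem wobblingGroup_map_eq {Γ : Type*} [Group Γ] [MulAction Γ X]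
    {μ : boundedFunctions X →ₗ[ℝ] ℝ}
    (hμ : ∀ (g : Γ) (f : boundedFunctions X), μ (boundedComp (g • ·) f) = μ f)
    {γ : Equiv.Perm X} (hγ : γ ∈ wobblingGroup Γ X) (f : boundedFunctions X) :
    μ (boundedComp γ f) = μ f := by
  classical
  obtain ⟨E, hE⟩ := hγ
  choose s hsE hs using hE
  -- `f` is cut along the `γ`-images of the pieces on which `γ` agrees with a single `σ`; on each
  -- part, composing with `γ` or with `σ` gives the same function.
  let h (σ : Γ) : boundedFunctions X := boundedIndicator {y | s (γ.symm y) = σ} f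
  have hf : f = ∑ σ ∈ E, h σ := by
    ext y
    rw [AddSubmonoidClass.coe_finsetSum, Finset.sum_apply,
      Finset.sum_eq_single_of_mem (s (γ.symm y)) (hsE _)]
    · simp [h, boundedIndicator]
    · intro σ _ hσ
      simp [h, boundedIndicator, hσ.symm]
  have hh (σ : Γ) : boundedComp γ (h σ) = boundedComp (σ • ·) (h σ) := by
    ext x
    change Set.indicator _ f.1 (γ x) = Set.indicator _ f.1 (σ • x)
    by_cases hx : s x = σ
    · rw [hs x, hx]
    · rw [Set.indicator_of_notMem (by simpa using hx), Set.indicator_of_notMem]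
      intro hc
      simp only [Set.mem_ofPred_eq] at hc
      have h1 := hs (γ.symm (σ • x))
      rw [hc, Equiv.apply_symm_apply, smul_left_cancel_iff] at h1
      exact hx (by rw [h1, hc])
  rw [hf, map_sum, map_sum, map_sum]
  exact Finset.sum_congr rfl fun σ _ => by rw [hh, hμ]

/-- A group acting freely on a set with an invariant mean is amenable. -/
theorem isAmenableGroup_of_free {H : Type*} [Group H] [MulAction H X]
    (hfree : ∀ (h : H) (x : X), h • x = x → h = 1)
    {μ : boundedFunctions X →ₗ[ℝ] ℝ} (hμ : IsMean μ)
    (hinv : ∀ (h : H) (f : boundedFunctions X), μ (boundedComp (h • ·) f) = μ f) :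
    IsAmenableGroup H := by
  let rep (x : X) : X := (Quotient.mk (MulAction.orbitRel H X) x).out
  have hrep (x : X) : ∃ h : H, h • rep x = x := by
    have h1 : (MulAction.orbitRel H X).r x (rep x) :=
      (MulAction.orbitRel H X).symm (Quotient.mk_out (s := MulAction.orbitRel H X) x)
    exact MulAction.orbitRel_apply.1 h1
  -- By freeness `θ x` is the only element taking the orbit representative to `x`, so `θ` is
  -- equivariant and carries the mean to `H`.
  choose θ hθ using hrep
  have hequi (h : H) (x : X) : θ (h • x) = h * θ x := by
    have h1 : rep (h • x) = rep x := by
      simp only [rep]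
      congr 1
      exact Quotient.sound (s := MulAction.orbitRel H X)
        (MulAction.orbitRel_apply.2 (MulAction.mem_orbit x h))
    have h2 : (h * θ x) • rep x = θ (h • x) • rep x := by
      rw [mul_smul, hθ, ← h1, hθ]
    have h3 := hfree ((θ (h • x))⁻¹ * (h * θ x)) (rep x) (by rw [mul_smul, h2, inv_smul_smul])
    exact inv_mul_eq_one.1 h3
  refine ⟨μ ∘ₗ boundedComp θ, (hμ.comp θ).nonneg, (hμ.comp θ).map_one, fun h f => ?_⟩
  refine Eq.trans ?_ (hinv h (boundedComp θ f))
  refine congrArg μ (Subtype.ext (funext fun x => ?_))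
  change f.1 (h * θ x) = f.1 (θ (h • x))
  rw [hequi]

/-- A group embedding semi-regularly into the wobbling group of an amenable action is amenable. -/
theorem isAmenableGroup_of_isoSemiRegularSubgroup {Γ : Type*} [Group Γ] [MulAction Γ X]
    (hX : IsAmenableAction Γ X) {H : Type*} [Group H]
    (hH : IsoSemiRegularSubgroup H (wobblingGroup Γ X)) : IsAmenableGroup H := by
  obtain ⟨μ, h0, h1, hinv⟩ := hX
  obtain ⟨S, hS, hreg, ⟨e⟩⟩ := hH
  let φ : H →* Equiv.Perm X := S.subtype.comp e.toMonoidHom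
  let : MulAction H X := MulAction.compHom X φ
  refine isAmenableGroup_of_free (X := X) (fun h x hx => ?_) ⟨h0, h1⟩
    fun h f => wobblingGroup_map_eq hinv (hS (e h).2) f
  by_contra hne
  refine hreg _ (e h).2 (fun hc => hne ?_) x hx
  exact e.injective (by rw [map_one]; exact Subtype.ext hc)

end Means

/-! ### Restriction of a sum of permutation families to a summand. -/

section Restriction

variable {I X J : Type*} (α : J → I → Equiv.Perm X)

theorem exists_restrict_permGroup_permSum (j : J) {σ : Equiv.Perm (X × J)}
    (hσ : σ ∈ permGroup (permSum α)) : ∃ ρ ∈ permGroup (α j), ∀ x, σ (x, j) = (ρ x, j) := by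
  induction hσ using Subgroup.closure_induction with
  | mem σ hσ =>
    obtain ⟨i, rfl⟩ := hσ
    exact ⟨α j i, Subgroup.subset_closure ⟨i, rfl⟩, fun x => rfl⟩
  | one => exact ⟨1, one_mem _, fun x => rfl⟩
  | mul σ τ _ _ hσ hτ =>
    obtain ⟨ρ, hρ, h1⟩ := hσ
    obtain ⟨π, hπ, h2⟩ := hτ
    exact ⟨ρ * π, mul_mem hρ hπ, fun x => by
      rw [Equiv.Perm.mul_apply, h2, h1, Equiv.Perm.mul_apply]⟩
  | inv σ _ hσ =>
    obtain ⟨ρ, hρ, h1⟩ := hσ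
    exact ⟨ρ⁻¹, inv_mem hρ, fun x => by
      rw [Equiv.Perm.inv_eq_iff_eq, h1, Equiv.Perm.inv_def, Equiv.apply_symm_apply]⟩

theorem exists_restrict_wobblingOf_permSum (j : J) {γ : Equiv.Perm (X × J)}
    (hγ : γ ∈ wobblingOf (permSum α)) :
    ∃ E : Finset (permGroup (α j)), ∀ x, ∃ g ∈ E, γ (x, j) = (g • x, j) := by
  classical
  obtain ⟨E, hE⟩ := hγ
  choose r hr hr' using fun σ : permGroup (permSum α) =>
    exists_restrict_permGroup_permSum α j σ.2
  refine ⟨E.image fun σ => ⟨r σ, hr σ⟩, fun x => ?_⟩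
  obtain ⟨g, hg, hx⟩ := hE (x, j)
  exact ⟨_, Finset.mem_image_of_mem _ hg, hx.trans (hr' g x)⟩

/-- Semi-regular subgroups of the wobbling group of a sum restrict to each summand. -/
theorem IsoSemiRegularSubgroup.restrict [Nonempty X] {H : Type*} [Group H]
    (hH : IsoSemiRegularSubgroup H (wobblingOf (permSum α))) (j : J) :
    IsoSemiRegularSubgroup H (wobblingOf (α j)) := by
  obtain ⟨S, hS, hreg, ⟨e⟩⟩ := hH
  have hfib (h : H) (x : X) : ((e h).1 (x, j)).2 = j := by
    obtain ⟨E, hE⟩ := exists_restrict_wobblingOf_permSum α j (hS (e h).2)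
    obtain ⟨g, -, hx⟩ := hE x
    rw [hx]
  have hpair (h : H) (x : X) : (e h).1 (x, j) = (((e h).1 (x, j)).1, j) :=
    Prod.ext rfl (hfib h x)
  let : MulAction H X :=
    { smul h x := ((e h).1 (x, j)).1
      one_smul x := by
        change ((e 1).1 (x, j)).1 = x
        rw [map_one]; rfl
      mul_smul g h x := by
        change ((e (g * h)).1 (x, j)).1 = ((e g).1 (((e h).1 (x, j)).1, j)).1
        rw [map_mul, ← hpair]; rfl }
  have hsmul (h : H) (x : X) : (e h).1 (x, j) = (h • x, j) := hpair h x
  have hfree (h : H) (hh : h ≠ 1) (x : X) : h • x ≠ x := by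
    intro hx
    refine hreg _ (e h).2 (fun hc => hh ?_) (x, j) (by rw [hsmul, hx])
    exact e.injective (by rw [map_one]; exact Subtype.ext hc)
  -- A free action is faithful only on a non-empty set.
  have hinj : Function.Injective (MulAction.toPermHom H X) := by
    rw [injective_iff_map_eq_one]
    intro h hh
    by_contra hne
    obtain ⟨x⟩ := ‹Nonempty X›
    exact hfree h hne x (DFunLike.congr_fun hh x)
  refine ⟨(MulAction.toPermHom H X).range, ?_, ?_, ⟨MonoidHom.ofInjective hinj⟩⟩
  · rintro _ ⟨h, rfl⟩
    obtain ⟨E, hE⟩ := exists_restrict_wobblingOf_permSum α j (hS (e h).2)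
    refine ⟨E, fun x => ?_⟩
    obtain ⟨g, hg, hx⟩ := hE x
    exact ⟨g, hg, (Prod.ext_iff.1 ((hsmul h x).symm.trans hx)).1⟩
  · rintro _ ⟨h, rfl⟩ hne x
    exact hfree h (fun hc => hne (by rw [hc, map_one])) x

end Restriction

/-! ### Pseudometrics subordinate to an entourage. -/

section Pseudometric

open Filter Uniformity

/-- Every entourage contains the open unit ball relation of a uniformly continuous pseudometric. -/
theorem exists_pseudoMetric_of_mem_uniformity {X : Type*} [UniformSpace X] {U : Set (X × X)}
    (hU : U ∈ 𝓤 X) : ∃ d : PseudoMetricSpace X,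
      (∀ x y, d.dist x y < 1 → (x, y) ∈ U) ∧
      ∀ ε > 0, {p : X × X | d.dist p.1 p.2 < ε} ∈ 𝓤 X := by
  have step (s : {s : Set (X × X) // s ∈ 𝓤 X}) : ∃ t : {s : Set (X × X) // s ∈ 𝓤 X},
      Prod.swap ⁻¹' t.1 = t.1 ∧ SetRel.comp t.1 t.1 ⊆ s.1 := by
    obtain ⟨t, ht, hsymm, hcomp⟩ := comp_symm_mem_uniformity_sets s.2
    exact ⟨⟨t, ht⟩, SetRel.inv_eq_self_iff.2 hsymm, hcomp⟩
  choose next hswap hcomp using step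
  let V : ℕ → {s : Set (X × X) // s ∈ 𝓤 X} := fun n => next^[n] ⟨U, hU⟩
  have hV (n : ℕ) : V (n + 1) = next (V n) := Function.iterate_succ_apply' ..
  have hrefl (n : ℕ) (x : X) : (x, x) ∈ (V n).1 := refl_mem_uniformity (V n).2
  have hanti : Antitone fun n => (V n).1 := antitone_nat_of_succ_le fun n => by
    rw [hV]
    intro p hp
    refine hcomp _ ⟨p.2, hp, ?_⟩
    rw [← hV]
    exact hrefl _ _
  have hbasis : (⨅ n, 𝓟 (V n).1).HasBasis (fun _ => True) fun n => (V n).1 :=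
    hasBasis_iInf_principal (directed_of_isDirected_le hanti)
  let c : UniformSpace.Core X :=
    { uniformity := ⨅ n, 𝓟 (V n).1
      refl := le_iInf fun n => principal_mono.2 <| by
        rintro ⟨x, y⟩ hxy
        obtain rfl : x = y := hxy
        exact hrefl n x
      symm := (hbasis.tendsto_iff hbasis).2 fun n _ => ⟨n + 1, trivial, fun p hp => by
        have h1 : p ∈ Prod.swap ⁻¹' (V (n + 1)).1 := by
          rw [hV, hswap, ← hV]
          exact hp
        exact hanti n.le_succ h1⟩
      comp := ((hbasis.lift' (monotone_id.relComp monotone_id)).le_basis_iff hbasis).2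
        fun n _ => ⟨n + 1, trivial, by
          change SetRel.comp (V (n + 1)).1 (V (n + 1)).1 ⊆ _
          rw [hV]
          exact hcomp _⟩ }
  have hle : 𝓤 X ≤ ⨅ n, 𝓟 (V n).1 := le_iInf fun n => le_principal_iff.2 (V n).2
  -- The chain `V n` generates a countably generated, hence pseudometrizable, uniformity coarser
  -- than the given one.
  let u : UniformSpace X := UniformSpace.ofCore c
  have hu : @uniformity X u = ⨅ n, 𝓟 (V n).1 := rfl
  have hcg : IsCountablyGenerated (@uniformity X u) := by
    rw [hu]
    infer_instance
  obtain ⟨d, hd⟩ := @UniformSpace.metrizable_uniformity X u hcg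
  have hdu : @uniformity X d.toUniformSpace = ⨅ n, 𝓟 (V n).1 := by rw [hd, hu]
  have hU' : U ∈ @uniformity X d.toUniformSpace := by
    rw [hdu]
    exact hbasis.mem_of_mem (i := 0) trivial
  obtain ⟨δ, hδ, hδU⟩ := (@Metric.mem_uniformity_dist X d U).1 hU'
  -- Rescaled so that the `δ`-ball relation, contained in `U`, becomes the unit one.
  let d' : PseudoMetricSpace X :=
    { dist x y := δ⁻¹ * d.dist x y
      dist_self x := by rw [d.dist_self, mul_zero]
      dist_comm x y := by rw [d.dist_comm]
      dist_triangle x y z := by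
        rw [← mul_add]
        exact mul_le_mul_of_nonneg_left (d.dist_triangle x y z) (inv_pos.2 hδ).le }
  refine ⟨d', fun x y hxy => hδU ?_, fun ε hε => ?_⟩
  · have h1 : δ⁻¹ * d.dist x y < 1 := hxy
    rwa [inv_mul_lt_iff₀ hδ, mul_one] at h1
  · have h1 := @Metric.dist_mem_uniformity X d (δ * ε) (mul_pos hδ hε)
    rw [hdu] at h1
    refine mem_of_superset (hle h1) fun p hp => ?_
    change δ⁻¹ * d.dist p.1 p.2 < ε
    rw [inv_mul_lt_iff₀ hδ]
    exact hp

end Pseudometric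

/-! ### From convex combinations to uniform averages. -/

section Averages

/-- A small convex combination of a bounded family is approximated by a uniform average. -/
theorem exists_average_of_convexCombination {V κ : Type*} [SeminormedAddCommGroup V]
    [NormedSpace ℝ V] [Fintype κ] {w : κ → ℝ} (hw : ∀ i, 0 ≤ w i) (hw1 : ∑ i, w i = 1)
    {a : κ → V} {C : ℝ} (ha : ∀ i, ‖a i‖ ≤ C) {ε : ℝ} (hε : ‖∑ i, w i • a i‖ < ε) :
    ∃ (n : ℕ) (x : Fin n → κ), 0 < n ∧ ‖∑ j, a (x j)‖ ≤ ε * n := by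
  set δ := ε - ‖∑ i, w i • a i‖ with hδ
  have hδ0 : 0 < δ := sub_pos.2 hε
  obtain ⟨N, hN⟩ := exists_nat_gt (max 0 (Fintype.card κ * C / δ))
  have hN0 : (0 : ℝ) < N := (le_max_left _ _).trans_lt hN
  have hNC : Fintype.card κ * C ≤ N * δ := by
    have := (le_max_right _ _).trans hN.le
    rwa [div_le_iff₀ hδ0] at this
  -- The index `i` is repeated `k i` times. Rounding costs at most `C` per index, and `N` is large
  -- enough for the slack `N * δ` to absorb this.
  let k (i : κ) : ℕ := ⌈N * w i⌉₊
  have hk1 (i : κ) : N * w i ≤ k i := Nat.le_ceil _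
  have hk2 (i : κ) : (k i : ℝ) - N * w i ≤ 1 := by
    have := (Nat.ceil_lt_add_one (mul_nonneg hN0.le (hw i))).le
    simp only [k]
    linarith
  let e := Fintype.equivFin (Σ i, Fin (k i))
  have hcard : Fintype.card (Σ i, Fin (k i)) = ∑ i, k i := by simp
  have hNn : (N : ℝ) ≤ Fintype.card (Σ i, Fin (k i)) := by
    rw [hcard, Nat.cast_sum]
    calc (N : ℝ) = ∑ i, N * w i := by rw [← Finset.mul_sum, hw1, mul_one]
      _ ≤ _ := Finset.sum_le_sum fun i _ => hk1 i
  refine ⟨_, fun j => (e.symm j).1, by exact_mod_cast hN0.trans_le hNn, ?_⟩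
  have hsum : ∑ j, a (e.symm j).1 = ∑ i, (k i : ℝ) • a i := by
    rw [e.symm.sum_comp fun p => a p.1, Fintype.sum_sigma]
    simp [Nat.cast_smul_eq_nsmul]
  have hsplit : ∑ i, (k i : ℝ) • a i
      = (N : ℝ) • ∑ i, w i • a i + ∑ i, ((k i : ℝ) - N * w i) • a i := by
    rw [Finset.smul_sum, ← Finset.sum_add_distrib]
    refine Finset.sum_congr rfl fun i _ => ?_
    rw [smul_smul, ← add_smul, add_sub_cancel]
  have hrest : ‖∑ i, ((k i : ℝ) - N * w i) • a i‖ ≤ Fintype.card κ * C := by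
    refine (norm_sum_le _ _).trans ?_
    calc _ ≤ ∑ _i : κ, C := Finset.sum_le_sum fun i _ => by
          rw [norm_smul, Real.norm_of_nonneg (sub_nonneg.2 (hk1 i))]
          exact (mul_le_of_le_one_left (norm_nonneg _) (hk2 i)).trans (ha i)
      _ = _ := by simp
  rw [hsum, hsplit]
  calc _ ≤ N * ‖∑ i, w i • a i‖ + Fintype.card κ * C := by
        refine (norm_add_le _ _).trans (add_le_add (le_of_eq ?_) hrest)
        rw [norm_smul, Real.norm_of_nonneg hN0.le]
    _ ≤ ε * N := by
        have : N * ‖∑ i, w i • a i‖ + N * δ = ε * N := by rw [hδ]; ring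
        linarith
    _ ≤ _ := mul_le_mul_of_nonneg_left hNn ((norm_nonneg _).trans hε.le)

end Averages

/-! ### Almost invariant averages from a mean on `RUC_b(G)`. -/

section Folner

variable {G : Type*} [Group G] [TopologicalSpace G] [IsTopologicalGroup G]

open scoped BoundedContinuousFunction

/-- The `[0, 1]`-valued functions that are `1`-Lipschitz for a given distance function. -/
def unitLipschitz {X : Type*} (d : X → X → ℝ) : Set (X → ℝ) :=
  {f | (∀ x, 0 ≤ f x ∧ f x ≤ 1) ∧ ∀ x y, |f x - f y| ≤ d x y}

/-- Evaluation at a point, as a bounded function on the unit Lipschitz functions. -/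
def lipschitzEval {X : Type*} (d : X → X → ℝ) (x : X) : unitLipschitz d →ᵇ ℝ :=
  BoundedContinuousFunction.ofNormedAddCommGroup (fun f => f.1 x)
    ((continuous_apply x).comp continuous_subtype_val) 1
    fun f => by rw [Real.norm_of_nonneg (f.2.1 x).1]; exact (f.2.1 x).2

theorem norm_lipschitzEval_le {X : Type*} (d : X → X → ℝ) (x : X) : ‖lipschitzEval d x‖ ≤ 1 :=
  BoundedContinuousFunction.norm_ofNormedAddCommGroup_le _ zero_le_one _

theorem norm_lipschitzEval_sub_le {X : Type*} (d : PseudoMetricSpace X) (x y : X) :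
    ‖lipschitzEval d.dist x - lipschitzEval d.dist y‖ ≤ d.dist x y :=
  (BoundedContinuousFunction.norm_le dist_nonneg).2 fun f => f.2.2 x y

/-- Evaluation is 1-Lipschitz from `d` to the sup norm, so `Λ` composed with it is Lipschitz for the
right uniformly continuous `d`. This makes the separating functionals of Hahn–Banach accessible to
the mean. -/
theorem continuousLinearMap_comp_lipschitzEval_mem_rucb (d : PseudoMetricSpace G)
    (hd : ∀ ε > 0, {p : G × G | d.dist p.1 p.2 < ε} ∈
      @uniformity G (IsTopologicalGroup.rightUniformSpace G))
    (Λ : (unitLipschitz d.dist →ᵇ ℝ) →L[ℝ] ℝ) :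
    (fun x => Λ (lipschitzEval d.dist x)) ∈ rucb G := by
  refine ⟨⟨‖Λ‖, fun x => ?_⟩, ?_⟩
  · exact (Λ.le_opNorm _).trans
      (mul_le_of_le_one_right (norm_nonneg _) (norm_lipschitzEval_le _ x))
  · let := IsTopologicalGroup.rightUniformSpace G
    refine Metric.uniformity_basis_dist.tendsto_right_iff.2 fun ε hε => ?_
    have hΛ : 0 < ‖Λ‖ + 1 := by positivity
    filter_upwards [hd (ε / (‖Λ‖ + 1)) (by positivity)] with p hp
    have hp' : d.dist p.1 p.2 < ε / (‖Λ‖ + 1) := hp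
    change dist (Λ _) (Λ _) < ε
    rw [dist_eq_norm, ← map_sub]
    calc _ ≤ ‖Λ‖ * d.dist p.1 p.2 := (Λ.le_opNorm _).trans
          (mul_le_mul_of_nonneg_left (norm_lipschitzEval_sub_le d _ _) (norm_nonneg _))
      _ ≤ (‖Λ‖ + 1) * d.dist p.1 p.2 := by
          rw [add_mul, one_mul]
          exact le_add_of_nonneg_right dist_nonneg
      _ < ε := by rwa [lt_div_iff₀' hΛ] at hp'

/-- In an amenable group, finite averages are almost invariant, uniformly over the unit Lipschitz
functions of a right uniformly continuous pseudometric. -/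
theorem IsAmenableTopGroup.exists_almost_invariant_average (hG : IsAmenableTopGroup G)
    (d : PseudoMetricSpace G)
    (hd : ∀ ε > 0, {p : G × G | d.dist p.1 p.2 < ε} ∈
      @uniformity G (IsTopologicalGroup.rightUniformSpace G))
    (E : Finset G) {ε : ℝ} (hε : 0 < ε) :
    ∃ (n : ℕ) (x : Fin n → G), 0 < n ∧ ∀ g ∈ E, ∀ f ∈ unitLipschitz d.dist,
      |∑ i, f (g * x i) - ∑ i, f (x i)| ≤ ε * n := by
  classical
  let ev := lipschitzEval d.dist
  let A (x : G) : E → (unitLipschitz d.dist →ᵇ ℝ) := fun g => ev (g.1 * x) - ev x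
  have hA (x : G) : ‖A x‖ ≤ 2 := (pi_norm_le_iff_of_nonneg zero_le_two).2 fun g => by
    refine (norm_sub_le _ _).trans ?_
    linarith [norm_lipschitzEval_le d.dist (g.1 * x), norm_lipschitzEval_le d.dist x]
  -- Otherwise some `Λ` satisfies `Λ (A x) > u > 0` for all `x`; but `Λ ∘ A` is a sum of differences
  -- `ψ g - φ g` of a translate and its original, so its mean is `0`.
  have key : (0 : E → (unitLipschitz d.dist →ᵇ ℝ)) ∈ closure (convexHull ℝ (Set.range A)) := by
    by_contra hnot
    obtain ⟨Λ, u, h0, hu⟩ := geometric_hahn_banach_point_closed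
      (convex_convexHull ℝ (Set.range A)).closure isClosed_closure hnot
    rw [map_zero] at h0
    obtain ⟨μ, hpos, hone, hinv⟩ := hG
    let φ (g : E) : rucb G := ⟨_, continuousLinearMap_comp_lipschitzEval_mem_rucb d hd
      (Λ.comp (ContinuousLinearMap.single ℝ (fun _ : E => unitLipschitz d.dist →ᵇ ℝ) g))⟩
    let ψ (g : E) : rucb G := ⟨fun x => (φ g).1 (g.1 * x), leftTranslate_mem_rucb g.1 (φ g).2⟩
    let F : rucb G := ∑ g, (ψ g - φ g) - u • ⟨1, one_mem_rucb G⟩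
    have hF : μ F = -u := by
      simp only [F, map_sub, map_sum, map_smul, hone]
      have h (g : E) : μ (ψ g) = μ (φ g) := hinv g.1 (φ g)
      simp [h]
    have hF0 : 0 ≤ μ F := hpos F fun x => by
      have h1 : u < Λ (A x) := hu _ (subset_closure (subset_convexHull ℝ _ ⟨x, rfl⟩))
      have h2 : Λ (A x) = ∑ g, ((φ g).1 (g.1 * x) - (φ g).1 x) := by
        rw [← Finset.univ_sum_single (A x), map_sum]
        refine Finset.sum_congr rfl fun g _ => ?_
        rw [Pi.single_sub, map_sub]
        rfl
      have h3 : F.1 x = ∑ g, ((φ g).1 (g.1 * x) - (φ g).1 x) - u := by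
        simp [F, ψ, Finset.sum_apply]
      rw [h3, ← h2]
      linarith
    linarith
  obtain ⟨b, hb, hbε⟩ := Metric.mem_closure_iff.1 key ε hε
  rw [dist_zero_left] at hbε
  obtain ⟨κ, _, w, z, hw, hw1, hz, rfl⟩ := mem_convexHull_iff_exists_fintype.1 hb
  choose y hy using hz
  obtain ⟨n, x, hn, hx⟩ := exists_average_of_convexCombination hw hw1
    (fun i => by rw [← hy i]; exact hA (y i)) hbε
  refine ⟨n, fun j => y (x j), hn, fun g hg f hf => ?_⟩
  have h1 := ((norm_le_pi_norm _ (⟨g, hg⟩ : E)).trans hx)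
  have h2 := (BoundedContinuousFunction.norm_coe_le_norm _
    (⟨f, hf⟩ : unitLipschitz d.dist)).trans h1
  rw [← Finset.sum_sub_distrib, ← Real.norm_eq_abs]
  refine le_of_eq_of_le (congrArg norm ?_) h2
  rw [Finset.sum_apply, BoundedContinuousFunction.sum_apply]
  refine Finset.sum_congr rfl fun j _ => ?_
  rw [← hy]
  rfl

end Folner

/-! ### Matchings, and permutations built from them. -/

section Matching

/-- Hall's marriage theorem with deficiency. -/
theorem exists_matching_of_deficiency {ι : Type*} [Fintype ι] [DecidableEq ι] (t : ι → Finset ι)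
    (m : ℕ) (h : ∀ S : Finset ι, S.card ≤ (S.biUnion t).card + m) :
    ∃ (D : Finset ι) (σ : ι → ι), Set.InjOn σ D ∧ (∀ i ∈ D, σ i ∈ t i) ∧
      Fintype.card ι ≤ D.card + m := by
  classical
  -- With `m` dummy partners available to everyone, Hall's condition holds, and at most `m` indices
  -- are matched to dummies.
  have hall : ∀ S : Finset ι, S.card ≤
      (S.biUnion fun i => (t i).disjSum (Finset.univ : Finset (Fin m))).card := by
    intro S
    obtain rfl | ⟨i₀, hi₀⟩ := S.eq_empty_or_nonempty
    · simp
    · refine (h S).trans ?_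
      have : (S.biUnion t).disjSum (Finset.univ : Finset (Fin m)) ⊆
          S.biUnion fun i => (t i).disjSum (Finset.univ : Finset (Fin m)) := by
        intro p hp
        rw [Finset.mem_biUnion]
        rcases p with j | k
        · obtain ⟨i, hi, hj⟩ := Finset.mem_biUnion.1 (Finset.inl_mem_disjSum.1 hp)
          exact ⟨i, hi, Finset.inl_mem_disjSum.2 hj⟩
        · exact ⟨i₀, hi₀, Finset.inr_mem_disjSum.2 (Finset.mem_univ k)⟩
      simpa using Finset.card_le_card this
  obtain ⟨s, hs, hst⟩ := (Finset.all_card_le_biUnion_card_iff_exists_injective _).1 hall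
  refine ⟨Finset.univ.filter fun i => (s i).isLeft, fun i => (s i).elim id fun _ => i, ?_, ?_, ?_⟩
  · intro i hi j hj hij
    simp only [Finset.coe_filter, Finset.mem_univ, true_and, Set.mem_ofPred_eq,
      Sum.isLeft_iff] at hi hj
    obtain ⟨a, ha⟩ := hi
    obtain ⟨b, hb⟩ := hj
    simp only [ha, hb, Sum.elim_inl, id] at hij
    exact hs (by rw [ha, hb, hij])
  · intro i hi
    simp only [Finset.mem_filter, Finset.mem_univ, true_and, Sum.isLeft_iff] at hi
    obtain ⟨a, ha⟩ := hi
    have := hst i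
    rw [ha, Finset.inl_mem_disjSum] at this
    simpa [ha] using this
  · have h1 := Finset.card_filter_add_card_filter_not (s := (Finset.univ : Finset ι))
      (fun i => (s i).isLeft = true)
    have h2 : (Finset.univ.filter fun i => ¬ (s i).isLeft = true).card ≤
        ((Finset.univ : Finset (Fin m)).map (Function.Embedding.inr (α := ι))).card := by
      refine Finset.card_le_card_of_injOn s (fun i hi => ?_) hs.injOn
      simp only [Finset.coe_filter, Finset.mem_univ, true_and, Set.mem_ofPred_eq, Bool.not_eq_true,
        Sum.isLeft_eq_false, Sum.isRight_iff] at hi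
      obtain ⟨a, ha⟩ := hi
      simp [ha]
    rw [Finset.card_map, Finset.card_univ, Fintype.card_fin] at h2
    rw [Finset.card_univ] at h1
    omega

open scoped NNReal in
/-- The unit Lipschitz function supported near a finite set. -/
theorem exists_unitLipschitz_bump {X ι : Type*} (d : PseudoMetricSpace X) (a : ι → X)
    (S : Finset ι) : ∃ f ∈ unitLipschitz d.dist, (∀ i ∈ S, f (a i) = 1) ∧
      ∀ y, f y ≠ 0 → ∃ i ∈ S, d.dist (a i) y < 1 := by
  -- Values in `ℝ≥0` make the supremum over an empty `S` equal to `0`.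
  let b (i : ι) (y : X) : ℝ≥0 := Real.toNNReal (1 - d.dist (a i) y)
  have hb (i : ι) (y : X) : b i y ≤ 1 := Real.toNNReal_le_one.2 <| by
    have : 0 ≤ d.dist (a i) y := dist_nonneg
    linarith
  let F (y : X) : ℝ≥0 := S.sup fun i => b i y
  have hF (y z : X) : F y ≤ F z + Real.toNNReal (d.dist y z) := by
    refine Finset.sup_le fun i hi => ?_
    refine le_trans ?_ (add_le_add_left (Finset.le_sup (f := fun i => b i z) hi) _)
    refine (Real.toNNReal_le_toNNReal ?_).trans Real.toNNReal_add_le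
    have := d.dist_triangle (a i) y z
    linarith
  have hF' (y z : X) : (F y : ℝ) ≤ F z + d.dist y z := by
    have := NNReal.coe_le_coe.2 (hF y z)
    rwa [NNReal.coe_add, Real.coe_toNNReal _ dist_nonneg] at this
  have hF1 (y : X) : F y ≤ 1 := Finset.sup_le fun i _ => hb i y
  refine ⟨fun y => F y, ⟨fun y => ⟨NNReal.coe_nonneg _, NNReal.coe_le_one.2 (hF1 y)⟩,
    fun y z => abs_sub_le_iff.2 ⟨?_, ?_⟩⟩, fun i hi => ?_, fun y hy => ?_⟩
  · linarith [hF' y z]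
  · have := hF' z y
    rw [d.dist_comm] at this
    linarith
  · refine NNReal.coe_eq_one.2 (le_antisymm (hF1 _) ?_)
    refine le_trans ?_ (Finset.le_sup (f := fun j => b j (a i)) hi)
    simp [b]
  · by_contra! hc
    refine hy (NNReal.coe_eq_zero.2 (le_antisymm (Finset.sup_le fun i hi => ?_) bot_le))
    exact (Real.toNNReal_of_nonpos (sub_nonpos.2 (hc i hi))).le

/-- If two finite families have nearly the same averages on unit Lipschitz functions, most of the
first family can be matched with nearby points of the second family. -/
theorem exists_matching_of_averages_close {X : Type*} (d : PseudoMetricSpace X) {n : ℕ}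
    (a b : Fin n → X) {c : ℝ} (hc : 0 ≤ c)
    (h : ∀ f ∈ unitLipschitz d.dist, |∑ i, f (a i) - ∑ i, f (b i)| ≤ c) :
    ∃ (D : Finset (Fin n)) (σ : Fin n → Fin n), Set.InjOn σ D ∧
      (∀ i ∈ D, d.dist (a i) (b (σ i)) < 1) ∧ (n : ℝ) - c ≤ D.card := by
  classical
  obtain ⟨D, σ, hσ, hD, hcard⟩ := exists_matching_of_deficiency
    (fun i => Finset.univ.filter fun j => d.dist (a i) (b j) < 1) ⌊c⌋₊ (by
      intro S
      obtain ⟨f, hf, hfS, hf0⟩ := exists_unitLipschitz_bump d a S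
      set N := S.biUnion fun i => Finset.univ.filter fun j => d.dist (a i) (b j) < 1
      have h1 : (S.card : ℝ) ≤ ∑ i, f (a i) := by
        calc (S.card : ℝ) = ∑ i ∈ S, f (a i) := by
              rw [Finset.sum_congr rfl hfS]; simp
          _ ≤ _ := Finset.sum_le_sum_of_subset_of_nonneg (Finset.subset_univ S)
              fun i _ _ => (hf.1 _).1
      have h2 : ∑ j, f (b j) ≤ N.card := by
        calc ∑ j, f (b j) = ∑ j ∈ N, f (b j) := by
              refine (Finset.sum_subset (Finset.subset_univ N) fun j _ hj => ?_).symm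
              by_contra hne
              obtain ⟨i, hi, hij⟩ := hf0 _ hne
              exact hj (Finset.mem_biUnion.2 ⟨i, hi, by simpa using hij⟩)
          _ ≤ ∑ j ∈ N, 1 := Finset.sum_le_sum fun j _ => (hf.1 _).2
          _ = _ := by simp
      have h3 := (abs_le.1 (h f hf)).2
      -- The bump function is `1` on the points of `S` and vanishes off their unit neighbours, so
      -- closeness of the sums bounds the Hall deficiency.
      have h4 : (S.card : ℝ) - N.card ≤ c := by linarith
      have h5 : S.card - N.card ≤ ⌊c⌋₊ := by
        rcases le_total S.card N.card with hle | hle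
        · simp [hle]
        · exact Nat.le_floor (by rwa [Nat.cast_sub hle])
      omega)
  refine ⟨D, σ, hσ, fun i hi => by simpa using hD i hi, ?_⟩
  rw [Fintype.card_fin] at hcard
  have h1 : (n : ℝ) ≤ D.card + ⌊c⌋₊ := by exact_mod_cast hcard
  linarith [Nat.floor_le hc]

/-- There is a permutation swapping two disjoint injective families pointwise. -/
theorem exists_perm_swap {X κ : Type*} {p q : κ → X} (hp : p.Injective) (hq : q.Injective)
    (hpq : ∀ i j, p i ≠ q j) : ∃ τ : Equiv.Perm X, (∀ k, τ (p k) = q k) ∧ (∀ k, τ (q k) = p k) ∧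
      ∀ y, (∀ k, y ≠ p k) → (∀ k, y ≠ q k) → τ y = y := by
  classical
  let ι : κ ⊕ κ ↪ X := ⟨Sum.elim p q, hp.sumElim hq hpq⟩
  refine ⟨Equiv.Perm.viaEmbedding (Equiv.sumComm κ κ) ι, fun k => ?_, fun k => ?_,
    fun y h1 h2 => Equiv.Perm.viaEmbedding_apply_of_notMem _ _ _ ?_⟩
  · exact Equiv.Perm.viaEmbedding_apply (Equiv.sumComm κ κ) ι (Sum.inl k)
  · exact Equiv.Perm.viaEmbedding_apply (Equiv.sumComm κ κ) ι (Sum.inr k)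
  · rintro ⟨k | k, rfl⟩
    · exact h1 k rfl
    · exact h2 k rfl

/-- Permutations supported on disjoint sets have a common extension. -/
theorem exists_perm_glue {X ι : Type*} (K : ι → Set X) (hK : ∀ i j x, x ∈ K i → x ∈ K j → i = j)
    (T : ι → Equiv.Perm X) (hT : ∀ i, ∀ x ∉ K i, T i x = x) :
    ∃ τ : Equiv.Perm X, (∀ i, ∀ x ∈ K i, τ x = T i x) ∧ ∀ x, (∀ i, x ∉ K i) → τ x = x := by
  classical
  let f (S : ι → Equiv.Perm X) (x : X) : X := if h : ∃ i, x ∈ K i then S h.choose x else x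
  have hf (S : ι → Equiv.Perm X) {i x} (hx : x ∈ K i) : f S x = S i x := by
    have h : ∃ i, x ∈ K i := ⟨i, hx⟩
    simp only [f, dif_pos h, hK _ _ x h.choose_spec hx]
  have hf' (S : ι → Equiv.Perm X) {x} (hx : ∀ i, x ∉ K i) : f S x = x :=
    dif_neg (not_exists.2 hx)
  have inv (S R : ι → Equiv.Perm X) (hS : ∀ i, ∀ x ∉ K i, R i x = x)
      (hRS : ∀ i x, R i (S i x) = x) (x : X) : f R (f S x) = x := by
    by_cases h : ∃ i, x ∈ K i
    · obtain ⟨i, hi⟩ := h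
      have hmem : S i x ∈ K i := by
        by_contra hn
        have h1 := hS i _ hn
        rw [hRS] at h1
        exact hn (h1 ▸ hi)
      rw [hf S hi, hf R hmem, hRS]
    · rw [hf' S (not_exists.1 h), hf' R (not_exists.1 h)]
  refine ⟨⟨f T, f fun i => (T i).symm, inv T _ (fun i x hx => ?_)
    fun i => (T i).symm_apply_apply, inv _ T hT fun i => (T i).apply_symm_apply⟩,
    fun i x hx => hf T hx, fun x hx => hf' T hx⟩
  rw [Equiv.symm_apply_eq, hT i x hx]

end Matching

/-! ### Greedy transfinite choices. -/

section Greedy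

/-- Greedy choice along a well-order, avoiding a finite set for each earlier choice. -/
theorem exists_greedy_choice {ι X : Type*} [LinearOrder ι] [WellFoundedLT ι] (O : ι → Set X)
    (K : ι → ι → X → Set X) (hK : ∀ i j x, (K i j x).Finite)
    (h : ∀ i (B : Set.Iio i → Set X), (∀ j, (B j).Finite) → (O i \ ⋃ j, B j).Nonempty) :
    ∃ x : ι → X, ∀ i, x i ∈ O i ∧ ∀ j < i, x i ∉ K i j (x j) := by
  let step (i : ι) (rec : ∀ j, j < i → X) : X :=
    (h i (fun j => K i j (rec j.1 j.2)) fun j => hK ..).some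
  let x : ι → X := (wellFounded_lt (α := ι)).fix step
  have hx (i : ι) : x i = step i fun j _ => x j := (wellFounded_lt (α := ι)).fix_eq step i
  refine ⟨x, fun i => ?_⟩
  have hmem := (h i (fun j => K i j (x j.1)) fun j => hK ..).some_mem
  have hx' : x i = (h i (fun j => K i j (x j.1)) fun j => hK ..).some := hx i
  rw [← hx'] at hmem
  exact ⟨hmem.1, fun j hj hc => hmem.2 (Set.mem_iUnion.2 ⟨⟨j, hj⟩, hc⟩)⟩

open Cardinal in
/-- At most `#G` finite subsets of an infinite group have disjoint right translates. -/
theorem exists_disjoint_translates.{u} {G ι : Type u} [Group G] [Infinite G] (hι : #ι ≤ #G)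
    (K : ι → Finset G) :
    ∃ y : ι → G, ∀ i j, ∀ a ∈ K i, ∀ b ∈ K j, a * y i = b * y j → i = j := by
  -- In a well-order of minimal type every proper initial segment has fewer than `#ι ≤ #G` elements,
  -- so the finite sets forbidden by earlier choices cannot cover `G`.
  obtain ⟨_, _, hord⟩ := exists_ord_eq_type_lt ι
  obtain ⟨y, hy⟩ := exists_greedy_choice (fun _ : ι => (Set.univ : Set G))
    (fun i j x => (fun p : G × G => p.1⁻¹ * (p.2 * x)) '' (K i ×ˢ K j : Finset (G × G)))
    (fun i j x => (Finset.finite_toSet _).image _) (by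
      intro i B hB
      by_contra hne
      rw [Set.not_nonempty_iff_eq_empty, Set.sdiff_eq_empty, Set.univ_subset_iff] at hne
      rcases finite_or_infinite (Set.Iio i) with hfin | hinf
      · exact Set.infinite_univ ((Set.finite_iUnion hB).subset hne.ge)
      · have h1 : #G ≤ #(Set.Iio i) := by
          calc #G = #(Set.univ : Set G) := mk_univ.symm
            _ ≤ #(⋃ j, B j) := mk_le_mk_of_subset hne.ge
            _ ≤ #(Set.Iio i) * ⨆ j, #(B j) := mk_iUnion_le B
            _ ≤ #(Set.Iio i) * ℵ₀ :=
              mul_le_mul_right (ciSup_le' fun j => (lt_aleph0_iff_set_finite.2 (hB j)).le) _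
            _ = #(Set.Iio i) := mul_aleph0_eq (aleph0_le_mk _)
        exact absurd (h1.trans_lt ((mk_Iio_lt i hord).trans_le hι)) (lt_irrefl _))
  have hlt {i j a b} (ha : a ∈ K i) (hb : b ∈ K j) (hab : a * y i = b * y j) : ¬ j < i :=
    fun hji => (hy i).2 j hji ⟨(a, b), by simp [ha, hb], by simp [← hab]⟩
  refine ⟨y, fun i j a ha b hb hab => ?_⟩
  rcases lt_trichotomy i j with h | h | h
  · exact absurd h (hlt hb ha hab.symm)
  · exact h
  · exact absurd h (hlt ha hb hab)

/-- A finite family can be chosen from infinite sets so as to avoid finitely many translation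
coincidences. -/
theorem exists_family_avoiding_translations {G : Type*} [Group G] {n : ℕ} (E : Finset G)
    (O : Fin n → Set G) (hO : ∀ i, (O i).Infinite) :
    ∃ x : Fin n → G, (∀ i, x i ∈ O i) ∧ x.Injective ∧
      ∀ g ∈ E, g ≠ 1 → ∀ i j, g * x i ≠ x j := by
  obtain ⟨x, hx⟩ := exists_greedy_choice O
    (fun _ _ z => insert z ((fun g => g * z) '' E ∪ (fun g => g⁻¹ * z) '' E))
    (fun _ _ z => ((E.finite_toSet.image _).union (E.finite_toSet.image _)).insert z)
    (fun i B hB => ((hO i).sdiff (Set.finite_iUnion hB)).nonempty)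
  have hne {i j} (hij : j < i) : x i ≠ x j ∧ ∀ g ∈ E, x i ≠ g * x j ∧ x i ≠ g⁻¹ * x j := by
    have := (hx i).2 j hij
    simp only [Set.mem_insert_iff, Set.mem_union, Set.mem_image, not_or, not_exists, not_and,
      Finset.mem_coe] at this
    exact ⟨this.1, fun g hg => ⟨fun h => this.2.1 g hg h.symm, fun h => this.2.2 g hg h.symm⟩⟩
  refine ⟨x, fun i => (hx i).1, fun i j hij => ?_, fun g hg hg1 i j h => ?_⟩
  · rcases lt_trichotomy i j with hlt | heq | hlt
    · exact absurd hij.symm (hne hlt).1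
    · exact heq
    · exact absurd hij (hne hlt).1
  · rcases lt_trichotomy i j with hlt | rfl | hlt
    · exact ((hne hlt).2 g hg).1 h.symm
    · exact hg1 (mul_eq_right.1 h)
    · exact ((hne hlt).2 g hg).2 (by rw [← h, inv_mul_cancel_left])

end Greedy

/-! ### Følner sets up to small permutations. -/

section FolnerPermutations

variable {G : Type*} [Group G] [TopologicalSpace G] [IsTopologicalGroup G]

/-- An isolated point could be translated to `1`, which would make `G` discrete. -/
theorem infinite_of_mem_nhds_of_not_discreteTopology [T2Space G] (hd : ¬ DiscreteTopology G)
    {x : G} {s : Set G} (hs : s ∈ 𝓝 x) : s.Infinite := by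
  have h1 : (𝓝[≠] x).NeBot := by
    refine ⟨fun hbot => ?_⟩
    have hx := isOpen_singleton_iff_punctured_nhds x |>.2 hbot
    refine hd (discreteTopology_of_isOpen_singleton_one ?_)
    have := (Homeomorph.mulRight x).isOpen_preimage.2 hx
    convert this
    ext y
    simp
  exact infinite_of_mem_nhds x hs

/-- In a non-discrete amenable Hausdorff group there are finite sets that are almost invariant up
to small permutations of the group with finite support. -/
theorem IsAmenableTopGroup.exists_folner_permutations [T2Space G] (hG : IsAmenableTopGroup G)
    (hd : ¬ DiscreteTopology G) {U : Set G} (hU : U ∈ 𝓝 (1 : G)) (E : Finset G) {ε : ℝ}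
    (hε : 0 < ε) :
    ∃ F K : Finset G, F.Nonempty ∧ F ⊆ K ∧ ∀ g ∈ E, ∃ (τ : Equiv.Perm G) (A : Finset G),
      (∀ y, τ y * y⁻¹ ∈ U) ∧ (∀ y ∉ K, τ y = y) ∧ A ⊆ F ∧ (∀ x ∈ A, τ (g * x) ∈ F) ∧
      (1 - ε) * F.card ≤ A.card := by
  classical
  -- Symmetry is needed because the final permutation swaps matched points, moving them in both
  -- directions.
  have hUU : U ∩ U⁻¹ ∈ 𝓝 (1 : G) := Filter.inter_mem hU (inv_mem_nhds_one G hU)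
  obtain ⟨V, hV, hVU⟩ := exists_nhds_one_split4 hUU
  have hV1 : (1 : G) ∈ V := mem_of_mem_nhds hV
  obtain ⟨d, hdV, hdu⟩ := @exists_pseudoMetric_of_mem_uniformity G
    (IsTopologicalGroup.rightUniformSpace G) {p | p.2 * p.1⁻¹ ∈ V} (Filter.preimage_mem_comap hV)
  obtain ⟨n, x, hn, hx⟩ := hG.exists_almost_invariant_average d hdu E hε
  let O (i : Fin n) : Set G :=
    {z | z * (x i)⁻¹ ∈ V} ∩ ⋂ g ∈ E, {z | (g * x i) * (g * z)⁻¹ ∈ V}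
  have hO (i : Fin n) : O i ∈ 𝓝 (x i) := by
    have hmem (f : G → G) (hf : Continuous f) (hf1 : f (x i) = 1) : {z | f z ∈ V} ∈ 𝓝 (x i) :=
      hf.continuousAt (by rwa [hf1])
    refine Filter.inter_mem (hmem _ (by fun_prop) (by simp)) ?_
    exact (Filter.biInter_finset_mem E).2 fun g _ => hmem _ (by fun_prop) (by simp)
  -- The points of the average may repeat or meet their translates; nearby replacements `x'` are
  -- distinct and disjoint from `g x'` for `1 ≠ g ∈ E`, as a swap requires.
  obtain ⟨x', hx'O, hinj, hdisj⟩ := exists_family_avoiding_translations E O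
    fun i => infinite_of_mem_nhds_of_not_discreteTopology hd (hO i)
  let F : Finset G := Finset.univ.image x'
  have hFcard : F.card = n := by
    rw [Finset.card_image_of_injective _ hinj, Finset.card_univ, Fintype.card_fin]
  have hF (i : Fin n) : x' i ∈ F := Finset.mem_image_of_mem _ (Finset.mem_univ i)
  refine ⟨F, F ∪ E.biUnion fun g => F.image (g * ·), ⟨x' ⟨0, hn⟩, hF _⟩,
    Finset.subset_union_left, fun g hg => ?_⟩
  by_cases hg1 : g = 1
  · refine ⟨1, F, fun y => by simpa using mem_of_mem_nhds hU, fun _ _ => rfl, subset_rfl,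
      fun y hy => by simpa [hg1] using hy, ?_⟩
    exact mul_le_of_le_one_left (Nat.cast_nonneg _) (by linarith)
  obtain ⟨D, σ, hσ, hDσ, hcard⟩ := exists_matching_of_averages_close d (fun i => g * x i) x
    (by positivity) (hx g hg)
  have hclose (i) (hi : i ∈ D) : x' (σ i) * (g * x' i)⁻¹ ∈ U ∩ U⁻¹ := by
    have h1 := (hx'O (σ i)).1
    have h2 : x (σ i) * (g * x i)⁻¹ ∈ V := hdV _ _ (hDσ i hi)
    have h3 : (g * x i) * (g * x' i)⁻¹ ∈ V := Set.mem_iInter₂.1 (hx'O i).2 g hg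
    -- The displacement factors through `x (σ i)` and `g * x i`: three factors in `V`, padded by
    -- `1`.
    have h4 := hVU h1 h2 h3 hV1
    convert h4 using 1
    group
  obtain ⟨τ, hτp, hτq, hτ⟩ := exists_perm_swap (p := fun k : D => g * x' k)
    (q := fun k : D => x' (σ k)) (fun i j h => Subtype.ext (hinj (mul_left_cancel h)))
    (fun i j h => Subtype.ext (hσ i.2 j.2 (hinj h))) (fun i j => hdisj g hg hg1 _ _)
  refine ⟨τ, D.image x', fun y => ?_, fun y hy => hτ y (fun k hk => hy ?_) fun k hk => hy ?_,
    Finset.image_subset_image (Finset.subset_univ D), fun y hy => ?_, ?_⟩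
  · by_cases hp : ∃ k : D, y = g * x' k
    · obtain ⟨k, rfl⟩ := hp
      rw [hτp k]
      exact (hclose k k.2).1
    by_cases hq : ∃ k : D, y = x' (σ k)
    · obtain ⟨k, rfl⟩ := hq
      rw [hτq k]
      have := (hclose k k.2).2
      rwa [Set.mem_inv, mul_inv_rev, inv_inv] at this
    · rw [hτ y (not_exists.1 hp) (not_exists.1 hq), mul_inv_cancel]
      exact mem_of_mem_nhds hU
  · rw [hk]
    exact Finset.mem_union_right _ (Finset.mem_biUnion.2 ⟨g, hg, Finset.mem_image_of_mem _ (hF _)⟩)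
  · rw [hk]
    exact Finset.mem_union_left _ (hF _)
  · obtain ⟨i, hi, rfl⟩ := Finset.mem_image.1 hy
    rw [hτp ⟨i, hi⟩]
    exact hF _
  · rw [hFcard, Finset.card_image_of_injective _ hinj]
    linarith

end FolnerPermutations

/-! ### Limit means along asymptotically invariant finite sets. -/

section LimitMean

open Filter

variable {X ι : Type*}

/-- Ultralimits of averages over finite sets are means. -/
theorem exists_mean_tendsto (𝒰 : Ultrafilter ι) (F : ι → Finset X) (hF : ∀ i, (F i).Nonempty) :
    ∃ μ : boundedFunctions X →ₗ[ℝ] ℝ, IsMean μ ∧ ∀ f : boundedFunctions X,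
      Tendsto (fun i => (∑ x ∈ F i, f.1 x) / (F i).card) 𝒰 (𝓝 (μ f)) := by
  have hpos (i : ι) : (0 : ℝ) < (F i).card := Nat.cast_pos.2 (hF i).card_pos
  have hlim (f : boundedFunctions X) :
      ∃ a, Tendsto (fun i => (∑ x ∈ F i, f.1 x) / (F i).card) 𝒰 (𝓝 a) := by
    obtain ⟨C, hC⟩ := f.2
    have hmem (i : ι) : (∑ x ∈ F i, f.1 x) / (F i).card ∈ Set.Icc (-C) C := by
      rw [Set.mem_Icc, ← abs_le, abs_div, abs_of_pos (hpos i), div_le_iff₀ (hpos i)]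
      calc _ ≤ ∑ x ∈ F i, |f.1 x| := Finset.abs_sum_le_sum_abs _ _
        _ ≤ ∑ x ∈ F i, C := Finset.sum_le_sum fun x _ => hC x
        _ = _ := by rw [Finset.sum_const, nsmul_eq_mul, mul_comm]
    obtain ⟨a, -, ha⟩ := (isCompact_Icc (a := -C) (b := C)).ultrafilter_le_nhds
      (𝒰.map fun i => (∑ x ∈ F i, f.1 x) / (F i).card)
      (le_principal_iff.2 (Filter.mem_map.2 (Eventually.of_forall hmem)))
    exact ⟨a, ha⟩
  choose m hm using hlim
  refine ⟨⟨⟨m, fun f g => tendsto_nhds_unique (hm (f + g)) ?_⟩,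
    fun c f => tendsto_nhds_unique (hm (c • f)) ?_⟩, ⟨fun f hf => ?_, ?_⟩, hm⟩
  · refine ((hm f).add (hm g)).congr fun i => ?_
    rw [← add_div, ← Finset.sum_add_distrib]
    rfl
  · refine ((hm f).const_mul c).congr fun i => ?_
    rw [← mul_div_assoc, Finset.mul_sum]
    rfl
  · exact ge_of_tendsto' (hm f) fun i =>
      div_nonneg (Finset.sum_nonneg fun x _ => hf x) (hpos i).le
  · refine tendsto_nhds_unique (hm _) (tendsto_const_nhds.congr fun i => ?_)
    simp [(hpos i).ne']

/-- The sum of `f ∘ γ` over `A` cancels that of `f` over `γ(A) ⊆ F`, leaving `|F| - |A|` terms on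
each side. -/
theorem abs_sum_comp_perm_sub_sum_le (γ : Equiv.Perm X) {A F : Finset X} (hA : A ⊆ F)
    (hAF : ∀ x ∈ A, γ x ∈ F) {f : X → ℝ} {C : ℝ} (hC : ∀ x, |f x| ≤ C) :
    |∑ x ∈ F, f (γ x) - ∑ x ∈ F, f x| ≤ 2 * C * (F.card - A.card) := by
  classical
  have hB : A.map γ.toEmbedding ⊆ F := fun y hy => by
    obtain ⟨x, hx, rfl⟩ := Finset.mem_map.1 hy
    exact hAF x hx
  have bound (B : Finset X) (hB : B ⊆ F) (hcard : B.card = A.card) (h : X → ℝ)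
      (hh : ∀ x, |h x| ≤ C) : |∑ x ∈ F \ B, h x| ≤ C * (F.card - A.card) := by
    calc _ ≤ ∑ x ∈ F \ B, |h x| := Finset.abs_sum_le_sum_abs _ _
      _ ≤ ∑ x ∈ F \ B, C := Finset.sum_le_sum fun x _ => hh x
      _ = _ := by
        rw [Finset.sum_const, nsmul_eq_mul, Finset.card_sdiff_of_subset hB,
          Nat.cast_sub (Finset.card_le_card hB), hcard, mul_comm]
  have h1 := abs_le.1 (bound A hA rfl (fun x => f (γ x)) fun x => hC _)
  have h2 := abs_le.1 (bound _ hB (Finset.card_map _) f hC)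
  have h3 := Finset.sum_sdiff hA (f := fun x => f (γ x))
  have h4 := Finset.sum_sdiff hB (f := f)
  rw [Finset.sum_map] at h4
  simp only [Equiv.coe_toEmbedding] at h4
  rw [abs_le]
  constructor <;> linarith

/-- A family of permutations with a net of asymptotically invariant finite sets generates an
amenable action. -/
theorem isAmenableAction_permGroup {I : Type*} (α : I → Equiv.Perm X) (l : Filter ι) [l.NeBot]
    (F : ι → Finset X) (hF : ∀ i, (F i).Nonempty) (ε : ι → ℝ) (hε : Tendsto ε l (𝓝 0))
    (h : ∀ g, ∀ᶠ i in l, ∃ A ⊆ F i, (∀ x ∈ A, α g x ∈ F i) ∧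
      (1 - ε i) * (F i).card ≤ A.card) :
    IsAmenableAction (permGroup α) X := by
  obtain ⟨μ, hμ, hlim⟩ := exists_mean_tendsto (Ultrafilter.of l) F hF
  have hgen (g : I) (f : boundedFunctions X) : μ (boundedComp (α g) f) = μ f := by
    obtain ⟨C, hC⟩ := f.2
    refine sub_eq_zero.1 (tendsto_nhds_unique ((hlim _).sub (hlim f)) ?_)
    refine squeeze_zero_norm' ?_ (((hε.const_mul (2 * C)).mono_left (Ultrafilter.of_le l)).trans_eq
      (by rw [mul_zero]))
    filter_upwards [Ultrafilter.of_le l (h g)] with i hi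
    obtain ⟨A, hA, hAF, hcard⟩ := hi
    have hpos : (0 : ℝ) < (F i).card := Nat.cast_pos.2 (hF i).card_pos
    rw [← sub_div, Real.norm_eq_abs, abs_div, abs_of_pos hpos, div_le_iff₀ hpos]
    refine (abs_sum_comp_perm_sub_sum_le (α g) hA hAF hC).trans ?_
    rw [mul_assoc (2 * C)]
    refine mul_le_mul_of_nonneg_left (by linarith) ?_
    obtain ⟨x, -⟩ := hF i
    have := (abs_nonneg _).trans (hC x)
    positivity
  have hall (σ : Equiv.Perm X) (hσ : σ ∈ permGroup α) :
      ∀ f : boundedFunctions X, μ (boundedComp σ f) = μ f := by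
    induction hσ using Subgroup.closure_induction with
    | mem σ hσ =>
      obtain ⟨g, rfl⟩ := hσ
      exact hgen g
    | one => exact fun f => rfl
    | mul σ τ _ _ hσ hτ => exact fun f => (hτ (boundedComp σ f)).trans (hσ f)
    | inv σ _ hσ =>
      intro f
      rw [← hσ (boundedComp (σ⁻¹ : Equiv.Perm X) f)]
      refine congrArg μ (Subtype.ext (funext fun x => ?_))
      exact congrArg f.1 (σ.symm_apply_apply x)
  exact ⟨μ, hμ.nonneg, hμ.map_one, fun g f => hall g.1 g.2 f⟩

theorem tendsto_card_finset_atTop (X : Type*) [Infinite X] :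
    Tendsto (fun E : Finset X => E.card) atTop atTop := by
  refine tendsto_atTop.2 fun N => ?_
  obtain ⟨s, hs⟩ := Infinite.exists_subset_card_eq X N
  filter_upwards [eventually_ge_atTop s] with E hE
  exact hs ▸ Finset.card_le_card hE

end LimitMean

/-! ### An amenable perturbation of left translation. -/

section Perturbation

variable {G : Type*} [Group G] [TopologicalSpace G] [IsTopologicalGroup G]

/-- In the discrete case `{1}` is a neighbourhood of `1`, so every bounded function lies in
`RUC_b(G)`. -/
theorem IsAmenableTopGroup.isAmenableAction_of_discreteTopology [DiscreteTopology G]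
    (hG : IsAmenableTopGroup G) :
    IsAmenableAction (permGroup fun g : G => Equiv.mulLeft g) G := by
  have hmem (f : boundedFunctions G) : f.1 ∈ rucb G := by
    refine ⟨f.2, fun s hs => ?_⟩
    let := IsTopologicalGroup.rightUniformSpace G
    change _ ∈ Filter.comap (fun p : G × G => p.2 * p.1⁻¹) (𝓝 1)
    rw [nhds_discrete, Filter.comap_pure]
    rintro ⟨x, y⟩ hxy
    obtain rfl : y = x := mul_inv_eq_one.1 hxy
    change (f.1 y, f.1 y) ∈ s
    exact refl_mem_uniformity hs
  obtain ⟨μ, hpos, hone, hinv⟩ := hG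
  have hrange (σ : permGroup fun g : G => Equiv.mulLeft g) : ∃ g : G, ∀ x, σ • x = g * x := by
    obtain ⟨σ, hσ⟩ := σ
    change ∃ g : G, ∀ x, σ x = g * x
    induction hσ using Subgroup.closure_induction with
    | mem σ hσ =>
      obtain ⟨g, rfl⟩ := hσ
      exact ⟨g, fun x => rfl⟩
    | one => exact ⟨1, fun x => (one_mul x).symm⟩
    | mul σ τ _ _ hσ hτ =>
      obtain ⟨g, hg⟩ := hσ
      obtain ⟨h, hh⟩ := hτ
      exact ⟨g * h, fun x => by rw [Equiv.Perm.mul_apply, hh, hg, mul_assoc]⟩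
    | inv σ _ hσ =>
      obtain ⟨g, hg⟩ := hσ
      exact ⟨g⁻¹, fun x => by rw [Equiv.Perm.inv_eq_iff_eq, hg, mul_inv_cancel_left]⟩
  refine ⟨⟨⟨fun f => μ ⟨f.1, hmem f⟩, fun f g => map_add μ ⟨f.1, hmem f⟩ ⟨g.1, hmem g⟩⟩,
    fun c f => map_smul μ c ⟨f.1, hmem f⟩⟩, fun f hf => hpos _ hf, hone, fun σ f => ?_⟩
  obtain ⟨g, hg⟩ := hrange σ
  refine Eq.trans ?_ (hinv g ⟨f.1, hmem f⟩)
  exact congrArg μ (Subtype.ext (funext fun x => congrArg f.1 (hg x)))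

/-- The left translation action of an amenable Hausdorff group admits arbitrarily small
perturbations that are amenable as actions on a set. -/
theorem IsAmenableTopGroup.exists_amenable_perturbation [T2Space G] (hG : IsAmenableTopGroup G)
    {U : Set G} (hU : U ∈ 𝓝 (1 : G)) :
    ∃ α ∈ perturbations U, IsAmenableAction (permGroup α) G := by
  classical
  by_cases hd : DiscreteTopology G
  · exact ⟨fun g => Equiv.mulLeft g, fun g h => ⟨1, mem_of_mem_nhds hU, (one_mul _).symm⟩,
      hG.isAmenableAction_of_discreteTopology⟩
  have : Infinite G := Set.infinite_univ_iff.1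
    (infinite_of_mem_nhds_of_not_discreteTopology hd (x := (1 : G)) Filter.univ_mem)
  let ε (E : Finset G) : ℝ := 1 / ((E.card : ℝ) + 1)
  choose F K hF hFK hT using fun E : Finset G =>
    hG.exists_folner_permutations hd hU E (show 0 < ε E by positivity)
  choose! T A hTU hTK hAF hTA hcard using hT
  obtain ⟨y, hy⟩ := exists_disjoint_translates (Cardinal.mk_finset_of_infinite G).le K
  let K' (g : G) (E : {E : Finset G // g ∈ E}) : Set G := {x | x * (y E)⁻¹ ∈ K E}
  -- Conjugating by a right translation moves the support into `K E * y E` without changing the set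
  -- of displacements `τ(x) x⁻¹`, and commutes with left multiplication.
  let T' (g : G) (E : {E : Finset G // g ∈ E}) : Equiv.Perm G :=
    (Equiv.mulRight (y E))⁻¹.trans ((T E g).trans (Equiv.mulRight (y E)))
  have hT' (g : G) (E : {E : Finset G // g ∈ E}) (x : G) :
      T' g E x = T E g (x * (y E)⁻¹) * y E := rfl
  have hglue (g : G) := exists_perm_glue (K' g)
    (fun E E' x hE hE' => Subtype.ext (hy E.1 E'.1 _ hE _ hE' (by simp))) (T' g)
    (fun E x hx => by rw [hT', hTK E.1 g E.2 _ hx, inv_mul_cancel_right])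
  choose τ hτ hτ' using hglue
  refine ⟨fun g => (Equiv.mulLeft g).trans (τ g), fun g h => ?_, ?_⟩
  · refine ⟨τ g (g * h) * (g * h)⁻¹, ?_, (inv_mul_cancel_right _ _).symm⟩
    by_cases hE : ∃ E, g * h ∈ K' g E
    · obtain ⟨E, hE⟩ := hE
      rw [hτ g E _ hE, hT']
      have := hTU E.1 g E.2 (g * h * (y E)⁻¹)
      rwa [mul_inv_rev, inv_inv, ← mul_assoc] at this
    · rw [hτ' g _ (not_exists.1 hE), mul_inv_cancel]
      exact mem_of_mem_nhds hU
  · refine isAmenableAction_permGroup _ Filter.atTop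
      (fun E => (F E).map (Equiv.mulRight (y E)).toEmbedding) (fun E => (hF E).map) ε
      (tendsto_one_div_add_atTop_nhds_zero_nat.comp (tendsto_card_finset_atTop G)) fun g => ?_
    filter_upwards [Filter.eventually_ge_atTop {g}] with E hE
    have hgE : g ∈ E := hE (Finset.mem_singleton_self g)
    refine ⟨(A E g).map (Equiv.mulRight (y E)).toEmbedding,
      Finset.map_subset_map.2 (hAF E g hgE), fun x hx => ?_, ?_⟩
    · obtain ⟨a, ha, rfl⟩ := Finset.mem_map.1 hx
      refine Finset.mem_map.2 ⟨T E g (g * a), hTA E g hgE a ha, ?_⟩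
      change T E g (g * a) * y E = τ g (g * (a * y E))
      have hK : g * (a * y E) ∈ K' g ⟨E, hgE⟩ := by
        change g * (a * y E) * (y E)⁻¹ ∈ K E
        rw [← mul_assoc, mul_inv_cancel_right]
        -- Outside `K E` the permutation `T E g` is the identity, so `g * a` would already lie in `F
        -- E ⊆ K E`.
        by_contra hn
        have h1 := hTA E g hgE a ha
        rw [hTK E g hgE _ hn] at h1
        exact hn (hFK E h1)
      rw [hτ g ⟨E, hgE⟩ _ hK, hT', ← mul_assoc, mul_inv_cancel_right]
    · rw [Finset.card_map, Finset.card_map]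
      exact hcard E g hgE

end Perturbation

theorem corollary5p13 {G : Type*} [Group G] [TopologicalSpace G] [IsTopologicalGroup G] [T2Space G]
    (hG : IsAmenableTopGroup G) {H : Type*} [Group H] :
    ((∃ U ∈ 𝓝 (1 : G), ∀ α ∈ perturbations U, IsoSemiRegularSubgroup H (wobblingOf α)) →
      IsAmenableGroup H) ∧
    (∀ U ∈ 𝓝 (1 : G), IsoSemiRegularSubgroup H (uniformWobblingGroup U) →
      ∀ α ∈ perturbations U, IsoSemiRegularSubgroup H (wobblingOf α)) := by
  refine ⟨fun ⟨U, hU, h⟩ => ?_, fun U _ h α hα => ?_⟩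
  · obtain ⟨α, hα, hact⟩ := hG.exists_amenable_perturbation hU
    exact isAmenableGroup_of_isoSemiRegularSubgroup hact (h α hα)
  · exact IsoSemiRegularSubgroup.restrict (fun α : perturbations U => α.1) h ⟨α, hα⟩
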